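/- **Conventions.** A subset $D$ of a poset is *directed* if it is nonempty and any two of its elements have an upper bound in $D$; a *dcpo* is a poset in which every directed subset has a supremum; $x\ll y$ means that for every directed $D$ having a supremum with $\sup D\ge y$ there is $d\in D$ with $x\le d$. A map between dcpos is *Scott continuous* if it preserves suprema of directed subsets; $[L\to L]$ is the poset of Scott continuous self-maps of $L$ with the pointwise order. An *FS-domain* is a nonempty dcpo $L$ for which there is a directed set $\mathcal D\subseteq[L\to L]$ with $\sup\mathcal D=\mathrm{id}_L$ such that for each $\delta\in\mathcal D$ there is a finite $M_\delta\subseteq L$ such that for all $x\in L$ there is $m\in M_\delta$ with $\delta(x)\le m\le x$. **FS-DOM** is the category of FS-domains and Scott continuous maps. For a relation $R$ on $U$ and $X\subseteq U$ put $\overline R(X)=\{x\in U\mid \exists y\in X,\ xRy\}$. A *CF-approximation space* $(U,R,\mathcal F)$ consists of a nonempty set $U$, a nonempty transitive relation $R$ on $U$ and a nonempty family $\mathcal F$ of finite (possibly empty) subsets of $U$ such that for all $F\in\mathcal F$ and all finite $K\subseteq\overline R(F)$ there is $G\in\mathcal F$ with $K\subseteq\overline R(G)$ and $G\subseteq\overline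 R(F)$. A *CF-approximable relation* from $(U_1,R_1,\mathcal F_1)$ to $(U_2,R_2,\mathcal F_2)$ is a relation $\Theta\subseteq\mathcal F_1\times\mathcal F_2$ such that, for all $F,F'\in\mathcal F_1$ and $G,G',G_1,G_2\in\mathcal F_2$: 1. there is $H\in\mathcal F_2$ with $F\,\Theta\,H$; 2. if $F\subseteq\overline{R_1}(F')$ and $F\,\Theta\,G$, then $F'\,\Theta\,G$; 3. if $F\,\Theta\,G$ and $G'\subseteq\overline{R_2}(G)$, then $F\,\Theta\,G'$; 4. if $F\,\Theta\,G$, there are $F''\in\mathcal F_1$, $G''\in\mathcal F_2$ with $F''\subseteq\overline{R_1}(F)$, $G\subseteq\overline{R_2}(G'')$ and $F''\,\Theta\,G''$; 5. if $F\,\Theta\,G_1$ and $F\,\Theta\,G_2$, there is $G_3\in\mathcal F_2$ with $G_1\cup G_2\subseteq\overline{R_2}(G_3)$ and $F\,\Theta\,G_3$. Put $\mathrm{Id}_{(U,R,\mathcal F)}=\{(F,G)\in\mathcal F\times\mathcal F\mid G\subseteq\overline R(F)\}$. A CF-approximation space $(U,R,\mathcal F)$ is an *FS-approximation space* if there is a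 family $\{\Theta_i\}_{i\in I}$, directed under inclusion, of CF-approximable relations from it to itself such that $\bigcup_{i}\Theta_i=\mathrm{Id}_{(U,R,\mathcal F)}$ and for every $i$ there is a finite $\mathcal M_i\subseteq\mathcal F$ such that for all $F\in\mathcal F$ there is $M\in\mathcal M_i$ with $$\forall G\in\mathcal F,\quad F\,\Theta_i\,G\ \Rightarrow\ G\subseteq\overline R(M)\subseteq\overline R(F).$$ **FS-APPS** is the category of FS-approximation spaces and CF-approximable relations, with composition of relations and identities $\mathrm{Id}_{(U,R,\mathcal F)}$. **Theorem.** The categories **FS-APPS** and **FS-DOM** are equivalent. Moreover, for an FS-domain $L$ let $\mathcal F_L$ be the family of finite subsets $F$ of $L$ having a top element $c_F$, and for a Scott continuous map $g:L_1\to L_2$ of FS-domains let $\Omega_g=\{(F,G)\in\mathcal F_{L_1}\times\mathcal F_{L_2}\mid c_G\ll g(c_F)\}$. Then $(L,\ll,\mathcal F_L)$ is an FS-approximation space, $\Omega_g$ is a CF-approximable relation, and $L\mapsto(L,\ll,\mathcal F_L)$, $g\mapsto\Omega_g$ defines a functor **FS-DOM** $\to$ **FS-APPS** which is full, faithful and essentially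 surjective. -/

import Mathlib

open CategoryTheory

universe u

namespace FSApprox

/-! ### Domains -/

/-- A directed subset of a poset (in particular nonempty). -/
def IsDirectedSet {P : Type u} [PartialOrder P] (D : Set P) : Prop :=
  D.Nonempty ∧ DirectedOn (· ≤ ·) D

/-- A poset is a dcpo if every directed subset has a supremum. -/
def IsDcpo (P : Type u) [PartialOrder P] : Prop :=
  ∀ D : Set P, IsDirectedSet D → ∃ s, IsLUB D s

/-- The way-below relation `x ≪ y`. -/
def WayBelow {P : Type u} [PartialOrder P] (x y : P) : Prop :=
  ∀ D : Set P, IsDirectedSet D → ∀ s, IsLUB D s → y ≤ s → ∃ d ∈ D, x ≤ d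

/-- Scott continuous maps `L ⟶ P`, i.e. the elements of `[L ⟶ P]`. -/
@[ext]
structure ScottMap (L P : Type u) [PartialOrder L] [PartialOrder P] where
  toFun : L → P
  scott : ScottContinuous toFun

/-- `[L ⟶ P]` carries the pointwise order. -/
instance ScottMap.instPartialOrder (L P : Type u) [PartialOrder L] [PartialOrder P] :
    PartialOrder (ScottMap L P) :=
  PartialOrder.lift ScottMap.toFun (fun _ _ h => ScottMap.ext h)

/-- The identity map. -/
def ScottMap.id (L : Type u) [PartialOrder L] : ScottMap L L :=
  ⟨fun x => x, ScottContinuous.id⟩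

/-- The composite `g ∘ f`. -/
def ScottMap.comp {L P Q : Type u} [PartialOrder L] [PartialOrder P] [PartialOrder Q]
    (g : ScottMap P Q) (f : ScottMap L P) : ScottMap L Q :=
  ⟨fun x => g.toFun (f.toFun x), f.scott.comp g.scott⟩

/-- An approximate identity for `L`: a directed subset of `[L ⟶ L]` whose supremum in
`[L ⟶ L]` is the identity. -/
def IsApproximateIdentity {L : Type u} [PartialOrder L] (D : Set (ScottMap L L)) : Prop :=
  IsDirectedSet D ∧ IsLUB D (ScottMap.id L)

/-- A finitely separating map. -/
def IsFinitelySeparating {L : Type u} [PartialOrder L] (δ : ScottMap L L) : Prop :=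
  ∃ M : Set L, M.Finite ∧ ∀ x, ∃ m ∈ M, δ.toFun x ≤ m ∧ m ≤ x

/-- An FS-domain: a dcpo with an approximate identity consisting of finitely separating maps. -/
def IsFSDomain (L : Type u) [PartialOrder L] : Prop :=
  IsDcpo L ∧ ∃ D : Set (ScottMap L L), IsApproximateIdentity D ∧ ∀ δ ∈ D, IsFinitelySeparating δ

/-- Objects of **FS-DOM**: (nonempty) FS-domains. -/
structure FSDom where
  carrier : Type u
  [order : PartialOrder carrier]
  [nonempty : Nonempty carrier]
  isFSDomain : IsFSDomain carrier

attribute [instance] FSDom.order FSDom.nonempty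

/-- **FS-DOM**: FS-domains with Scott continuous maps. -/
instance FSDom.instCategory : Category.{u} FSDom.{u} where
  Hom L P := ScottMap L.carrier P.carrier
  id L := ScottMap.id L.carrier
  comp f g := ScottMap.comp g f
  id_comp _ := rfl
  comp_id _ := rfl
  assoc _ _ _ := rfl

/-! ### Approximation spaces -/

/-- The data `(U, R, 𝓕)`: a set, a binary relation, and a family of finite subsets. -/
structure ApproxTriple where
  carrier : Type u
  rel : carrier → carrier → Prop
  family : Set (Finset carrier)

namespace ApproxTriple

/-- `R_s(x) = {y | x R y}`. -/
def succSet (A : ApproxTriple.{u}) (x : A.carrier) : Set A.carrier :=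
  {y | A.rel x y}

/-- The upper approximation operator: `R̄(X) = {x | R_s(x) ∩ X ≠ ∅}`. -/
def upper (A : ApproxTriple.{u}) (X : Set A.carrier) : Set A.carrier :=
  {x | (A.succSet x ∩ X).Nonempty}

/-- `R̄(F)` for a member `F` of the family. -/
def up (A : ApproxTriple.{u}) (F : A.family) : Set A.carrier :=
  A.upper (F.1 : Set A.carrier)

/-- CF-approximation spaces: `U` and `R` are nonempty, `R` is transitive, the family is nonempty,
and every finite `K ⊆ R̄(F)` with `F` in the family satisfies `K ⊆ R̄(G)` for some `G ⊆ R̄(F)` in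
the family. -/
structure IsCF (A : ApproxTriple.{u}) : Prop where
  carrier_nonempty : Nonempty A.carrier
  rel_nonempty : ∃ x y, A.rel x y
  rel_trans : ∀ x y z, A.rel x y → A.rel y z → A.rel x z
  family_nonempty : A.family.Nonempty
  consistent : ∀ F : A.family, ∀ K : Finset A.carrier, (K : Set A.carrier) ⊆ A.up F →
    ∃ G : A.family, (K : Set A.carrier) ⊆ A.up G ∧ (G.1 : Set A.carrier) ⊆ A.up F

/-- `Id = {(F, G) | G ⊆ R̄(F)}`. -/
def idRel (A : ApproxTriple.{u}) : A.family → A.family → Prop :=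
  fun F G => (G.1 : Set A.carrier) ⊆ A.up F

end ApproxTriple

/-- CF-approximable relations `Θ ⊆ 𝓕₁ × 𝓕₂`. -/
structure IsCFApproximable {A B : ApproxTriple.{u}} (Θ : A.family → B.family → Prop) : Prop where
  total : ∀ F, ∃ G, Θ F G
  left : ∀ F F' G, (F.1 : Set A.carrier) ⊆ A.up F' → Θ F G → Θ F' G
  right : ∀ F G G', Θ F G → (G'.1 : Set B.carrier) ⊆ B.up G → Θ F G'
  interpolate : ∀ F G, Θ F G → ∃ F' G', (F'.1 : Set A.carrier) ⊆ A.up F ∧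
    (G.1 : Set B.carrier) ⊆ B.up G' ∧ Θ F' G'
  directed : ∀ F G₁ G₂, Θ F G₁ → Θ F G₂ → ∃ G₃,
    (G₁.1 : Set B.carrier) ∪ (G₂.1 : Set B.carrier) ⊆ B.up G₃ ∧ Θ F G₃

/-- FS-approximation spaces: CF-approximation spaces with a directed (under inclusion) family of
CF-approximable relations satisfying the two conditions (FS 1) and (FS 2). -/
def ApproxTriple.IsFS (A : ApproxTriple.{u}) : Prop :=
  A.IsCF ∧ ∃ S : Set (A.family → A.family → Prop),
    IsDirectedSet S ∧ (∀ Θ ∈ S, IsCFApproximable Θ) ∧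
    (∀ F G, (∃ Θ ∈ S, Θ F G) ↔ A.idRel F G) ∧
    (∀ Θ ∈ S, ∃ 𝓜 : Set A.family, 𝓜.Finite ∧ ∀ F, ∃ M ∈ 𝓜,
      ∀ G, Θ F G → (G.1 : Set A.carrier) ⊆ A.up M ∧ A.up M ⊆ A.up F)

/-! ### The category of FS-approximation spaces -/

/-- If `F ⊆ R̄(G)` and `R` is transitive then `R̄(F) ⊆ R̄(G)`. -/
theorem ApproxTriple.IsCF.up_mono {A : ApproxTriple.{u}} (hA : A.IsCF) {F G : A.family}
    (h : (F.1 : Set A.carrier) ⊆ A.up G) : A.up F ⊆ A.up G := by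
  rintro x ⟨y, hxy, hy⟩
  obtain ⟨z, hyz, hz⟩ := h hy
  exact ⟨z, hA.rel_trans _ _ _ hxy hyz, hz⟩

theorem isCFApproximable_idRel {A : ApproxTriple.{u}} (hA : A.IsCF) :
    IsCFApproximable A.idRel where
  total F := by
    obtain ⟨G, -, hG⟩ := hA.consistent F ∅ (by simp)
    exact ⟨G, hG⟩
  left _ _ _ h hG := hG.trans (hA.up_mono h)
  right _ _ _ h hG := hG.trans (hA.up_mono h)
  interpolate F G h := by
    obtain ⟨G', h1, h2⟩ := hA.consistent F G.1 h
    obtain ⟨G'', h3, h4⟩ := hA.consistent F G'.1 h2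
    exact ⟨G'', G', h4, h1, h3⟩
  directed F G₁ G₂ h1 h2 := by
    classical
    obtain ⟨G₃, h3, h4⟩ := hA.consistent F (G₁.1 ∪ G₂.1) (by
      rw [Finset.coe_union]; exact Set.union_subset h1 h2)
    rw [Finset.coe_union] at h3
    exact ⟨G₃, h3, h4⟩

/-- Composition `Υ ∘ Θ` of relations. -/
def compRel {A B C : ApproxTriple.{u}} (Υ : B.family → C.family → Prop)
    (Θ : A.family → B.family → Prop) : A.family → C.family → Prop :=
  fun F H => ∃ G, Θ F G ∧ Υ G H

theorem IsCFApproximable.comp {A B C : ApproxTriple.{u}} {Υ : B.family → C.family → Prop}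
    {Θ : A.family → B.family → Prop} (hΥ : IsCFApproximable Υ) (hΘ : IsCFApproximable Θ) :
    IsCFApproximable (compRel Υ Θ) where
  total F := by
    obtain ⟨G, hG⟩ := hΘ.total F
    obtain ⟨H, hH⟩ := hΥ.total G
    exact ⟨H, G, hG, hH⟩
  left F F' H hF := by
    rintro ⟨G, h1, h2⟩
    exact ⟨G, hΘ.left _ _ _ hF h1, h2⟩
  right F H H' := by
    rintro ⟨G, h1, h2⟩ hH
    exact ⟨G, h1, hΥ.right _ _ _ h2 hH⟩
  interpolate F H := by
    rintro ⟨G, h1, h2⟩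
    obtain ⟨F', G', hF, hG, h3⟩ := hΘ.interpolate _ _ h1
    obtain ⟨G'', H', hG', hH, h4⟩ := hΥ.interpolate _ _ h2
    exact ⟨F', H', hF, hH, G, hΘ.right _ _ _ h3 hG, hΥ.left _ _ _ hG' h4⟩
  directed F H₁ H₂ := by
    rintro ⟨G₁, h1, h2⟩ ⟨G₂, h3, h4⟩
    obtain ⟨G, hG, hFG⟩ := hΘ.directed _ _ _ h1 h3
    obtain ⟨H, hH, hGH⟩ := hΥ.directed G H₁ H₂
      (hΥ.left _ _ _ (Set.subset_union_left.trans hG) h2)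
      (hΥ.left _ _ _ (Set.subset_union_right.trans hG) h4)
    exact ⟨H, hH, G, hFG, hGH⟩

/-- Objects of **FS-APPS**: FS-approximation spaces. -/
structure FSApps where
  triple : ApproxTriple.{u}
  isFS : triple.IsFS

/-- Morphisms of **FS-APPS**: CF-approximable relations. -/
@[ext]
structure FSApps.Hom (A B : FSApps.{u}) where
  rel : A.triple.family → B.triple.family → Prop
  isCFApproximable : IsCFApproximable rel

/-- **FS-APPS**: FS-approximation spaces with CF-approximable relations. -/
instance FSApps.instCategory : Category.{u} FSApps.{u} where
  Hom A B := FSApps.Hom A B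
  id A := ⟨A.triple.idRel, isCFApproximable_idRel A.isFS.1⟩
  comp Θ Υ := ⟨compRel Υ.rel Θ.rel, Υ.isCFApproximable.comp Θ.isCFApproximable⟩
  id_comp Θ := by
    apply FSApps.Hom.ext
    funext F H
    apply propext
    constructor
    · rintro ⟨G, h1, h2⟩
      exact Θ.isCFApproximable.left _ _ _ h1 h2
    · intro h
      obtain ⟨F', G', hF, hG, h3⟩ := Θ.isCFApproximable.interpolate _ _ h
      exact ⟨F', hF, Θ.isCFApproximable.right _ _ _ h3 hG⟩
  comp_id Θ := by
    apply FSApps.Hom.ext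
    funext F H
    apply propext
    constructor
    · rintro ⟨G, h1, h2⟩
      exact Θ.isCFApproximable.right _ _ _ h1 h2
    · intro h
      obtain ⟨F', G', hF, hG, h3⟩ := Θ.isCFApproximable.interpolate _ _ h
      exact ⟨G', Θ.isCFApproximable.left _ _ _ hF h3, hG⟩
  assoc Θ Υ Ψ := by
    apply FSApps.Hom.ext
    funext F H
    apply propext
    constructor
    · rintro ⟨G, ⟨K, h1, h2⟩, h3⟩
      exact ⟨K, h1, G, h2, h3⟩
    · rintro ⟨K, h1, G, h2, h3⟩
      exact ⟨G, ⟨K, h1, h2⟩, h3⟩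

/-! ### The induced space and the relations `Ω_g` -/

/-- The triple `(L, ≪, 𝓕_L)` induced by a poset `L`, where `𝓕_L` consists of the finite subsets of
`L` having a top element. -/
def induced (L : Type u) [PartialOrder L] : ApproxTriple.{u} where
  carrier := L
  rel := WayBelow
  family := {F | ∃ c, IsGreatest (F : Set L) c}

/-- The top element `c_F` of `F ∈ 𝓕_L`. -/
noncomputable def topElt {L : Type u} [PartialOrder L] (F : (induced L).family) : L :=
  F.2.choose

theorem isGreatest_topElt {L : Type u} [PartialOrder L] (F : (induced L).family) :
    IsGreatest {x : L | x ∈ F.1} (topElt F) :=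
  F.2.choose_spec

/-- `Ω_g = {(F, G) | c_G ≪ g(c_F)}`. -/
def Omega {L P : Type u} [PartialOrder L] [PartialOrder P] (g : ScottMap L P) :
    (induced L).family → (induced P).family → Prop :=
  fun F G => WayBelow (topElt G) (g.toFun (topElt F))

/-- The object of **FS-APPS** given by the induced triple of `L`, once it is known to be an
FS-approximation space. -/
def inducedObj (hobj : ∀ L : FSDom.{u}, (induced L.carrier).IsFS) (L : FSDom.{u}) : FSApps.{u} :=
  ⟨induced L.carrier, hobj L⟩

/-- The morphism of **FS-APPS** given by `Ω_g`, once it is known to be CF-approximable. -/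
def inducedMap (hobj : ∀ L : FSDom.{u}, (induced L.carrier).IsFS)
    (hmap : ∀ (L P : FSDom.{u}) (g : ScottMap L.carrier P.carrier), IsCFApproximable (Omega g))
    {L P : FSDom.{u}} (g : L ⟶ P) : inducedObj hobj L ⟶ inducedObj hobj P :=
  FSApps.Hom.mk (A := inducedObj hobj L) (B := inducedObj hobj P) (Omega g) (hmap L P g)

/-- The functor `Φ : FS-DOM ⥤ FS-APPS`, `L ↦ (L, ≪, 𝓕_L)`, `g ↦ Ω_g`, once well-definedness and
functoriality are known. -/
def inducedFunctor (hobj : ∀ L : FSDom.{u}, (induced L.carrier).IsFS)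
    (hmap : ∀ (L P : FSDom.{u}) (g : ScottMap L.carrier P.carrier), IsCFApproximable (Omega g))
    (hid : ∀ L : FSDom.{u}, inducedMap hobj hmap (𝟙 L) = 𝟙 (inducedObj hobj L))
    (hcomp : ∀ (L P Q : FSDom.{u}) (h : L ⟶ P) (g : P ⟶ Q),
      inducedMap hobj hmap (h ≫ g) = inducedMap hobj hmap h ≫ inducedMap hobj hmap g) :
    FSDom.{u} ⥤ FSApps.{u} where
  obj := inducedObj hobj
  map := inducedMap hobj hmap
  map_id := hid
  map_comp := hcomp _ _ _

end FSApprox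

/-!
The proof factors through continuous dcpos, i.e. dcpos in which every `y` is the directed supremum
of the elements way below it.

* An FS-domain is continuous: a finitely separating map `δ` satisfies `δ x ≪ x`
  (`IsFinitelySeparating.wayBelow`). Indeed, `M_δ` being finite, a directed set `D` with
  `x ≤ sup D` has a cofinal subset on which a single `m ∈ M_δ` satisfies `δ d ≤ m ≤ d`
  (`exists_cofinal_of_finite`), so that `δ x ≤ sup (δ D) ≤ m ≤ d`. Moreover, the identity is the
  pointwise supremum of an approximate identity (`isLUB_apply`).

* For continuous dcpos, `F ⊆ R̄(G)` in the induced space just says `c_F ≪ c_G`, and the axioms of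
  CF-approximable relations for `Ω_g` as well as functoriality are instances of the interpolation
  property of `≪`. A Scott continuous map is recovered from `Ω_g` by
  `g x = sup {c_G | {x} Ω_g G}`, and the same formula turns an arbitrary CF-approximable relation
  into a Scott continuous map (`exists_Omega_eq`); this gives faithfulness and fullness.

* For essential surjectivity, `G ⊆ R̄(F)` makes the family `𝓕` of a CF-approximation space an
  abstract basis, and the domain attached to the space is its rounded ideal completion
  `RoundedIdeal`. There `I ≪ J` holds exactly if `I` lies in the principal ideal of some `G ∈ J`
  (`wayBelow_iff`). A CF-approximable relation `Θ` acts on rounded ideals by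
  `I ↦ {G | ∃ F ∈ I, F Θ G}` (`idealMap`), and these maps for the relations `Θ_i` of an
  FS-approximation space exhibit its ideal completion as an FS-domain. The space is isomorphic to
  the space induced by the completion via `F ↦ {G | G ∈ c_F}` and `G ↦ {F | c_F ≪ ↓G}`.
-/

namespace FSApprox

/-! ### Directed sets -/

theorem exists_upper_bound_of_finite {α β : Type*} {r : α → α → Prop}
    (htrans : ∀ a b c, r a b → r b c → r a c) {D : Set α} (hne : D.Nonempty)
    (hD : DirectedOn r D) {M : Set β} (hM : M.Finite) (f : β → α) (hf : ∀ m ∈ M, f m ∈ D) :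
    ∃ b ∈ D, ∀ m ∈ M, r (f m) b := by
  induction M, hM using Set.Finite.induction_on with
  | empty => exact ⟨hne.some, hne.some_mem, by simp⟩
  | @insert a s _ _ ih =>
    obtain ⟨b, hb, h⟩ := ih fun m hm => hf m (Set.mem_insert_of_mem _ hm)
    obtain ⟨c, hc, hac, hbc⟩ := hD _ (hf a (Set.mem_insert _ _)) b hb
    refine ⟨c, hc, fun m hm => ?_⟩
    rcases hm with rfl | hm
    · exact hac
    · exact htrans _ _ _ (h m hm) hbc

/-- Pigeonhole principle for directed sets: if a directed set is covered by finitely many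
subsets, one of them is cofinal. -/
theorem exists_cofinal_of_finite {α β : Type*} {r : α → α → Prop}
    (htrans : ∀ a b c, r a b → r b c → r a c) {D : Set α} (hne : D.Nonempty)
    (hD : DirectedOn r D) {M : Set β} (hM : M.Finite) {p : α → β → Prop}
    (hp : ∀ a ∈ D, ∃ m ∈ M, p a m) :
    ∃ m ∈ M, ∀ a ∈ D, ∃ b ∈ D, r a b ∧ p b m := by
  by_contra! h
  have h' : ∀ m, ∃ a, m ∈ M → a ∈ D ∧ ∀ b ∈ D, r a b → ¬ p b m := fun m => by
    by_cases hm : m ∈ M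
    · obtain ⟨a, ha⟩ := h m hm
      exact ⟨a, fun _ => ha⟩
    · exact ⟨hne.some, fun hm' => absurd hm' hm⟩
  choose f hf using h'
  obtain ⟨b, hb, hfb⟩ := exists_upper_bound_of_finite htrans hne hD hM f fun m hm => (hf m hm).1
  obtain ⟨m, hm, hbm⟩ := hp b hb
  exact (hf m hm).2 b hb (hfb m hm) hbm

/-! ### The way-below relation and continuous dcpos -/

section Order

variable {L P : Type u} [PartialOrder L] [PartialOrder P]

theorem isDirectedSet_singleton (x : L) : IsDirectedSet {x} :=
  ⟨Set.singleton_nonempty x, directedOn_singleton x⟩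

theorem IsDirectedSet.image {D : Set L} (hD : IsDirectedSet D) {f : L → P} (hf : Monotone f) :
    IsDirectedSet (f '' D) := by
  refine ⟨hD.1.image f, ?_⟩
  rintro _ ⟨x, hx, rfl⟩ _ ⟨y, hy, rfl⟩
  obtain ⟨z, hz, hxz, hyz⟩ := hD.2 x hx y hy
  exact ⟨f z, ⟨z, hz, rfl⟩, hf hxz, hf hyz⟩

theorem WayBelow.le {x y : L} (h : WayBelow x y) : x ≤ y := by
  obtain ⟨d, rfl, hd⟩ := h {y} (isDirectedSet_singleton y) y isLUB_singleton le_rfl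
  exact hd

theorem WayBelow.trans_le {x y z : L} (h : WayBelow x y) (hyz : y ≤ z) : WayBelow x z :=
  fun D hD s hs hz => h D hD s hs (hyz.trans hz)

theorem WayBelow.le_trans {x y z : L} (hxy : x ≤ y) (h : WayBelow y z) : WayBelow x z :=
  fun D hD s hs hz => by
    obtain ⟨d, hd, hyd⟩ := h D hD s hs hz
    exact ⟨d, hd, hxy.trans hyd⟩

theorem WayBelow.trans {x y z : L} (hxy : WayBelow x y) (hyz : WayBelow y z) : WayBelow x z :=
  hxy.trans_le hyz.le

theorem ScottMap.monotone (f : ScottMap L P) : Monotone f.toFun :=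
  f.scott.monotone

/-- A continuous dcpo: every element is the directed supremum of the elements way below it. -/
structure IsContinuousDcpo (L : Type u) [PartialOrder L] : Prop where
  isDcpo : IsDcpo L
  isDirectedSet : ∀ y : L, IsDirectedSet {z | WayBelow z y}
  isLUB : ∀ y : L, IsLUB {z | WayBelow z y} y

namespace IsContinuousDcpo

theorem exists_wayBelow (hL : IsContinuousDcpo L) (y : L) : ∃ z, WayBelow z y :=
  (hL.isDirectedSet y).1

theorem interpolate (hL : IsContinuousDcpo L) {x y : L} (h : WayBelow x y) :
    ∃ z, WayBelow x z ∧ WayBelow z y := by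
  -- the elements two steps below `y` already form a directed set with supremum `y`
  have hdir : IsDirectedSet {z | ∃ w, WayBelow z w ∧ WayBelow w y} := by
    constructor
    · obtain ⟨w, hw⟩ := hL.exists_wayBelow y
      obtain ⟨z, hz⟩ := hL.exists_wayBelow w
      exact ⟨z, w, hz, hw⟩
    · rintro a ⟨a', haa', ha'⟩ b ⟨b', hbb', hb'⟩
      obtain ⟨c', hc', hac', hbc'⟩ := (hL.isDirectedSet y).2 a' ha' b' hb'
      obtain ⟨c, hc, hac, hbc⟩ :=
        (hL.isDirectedSet c').2 a (haa'.trans_le hac') b (hbb'.trans_le hbc')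
      exact ⟨c, ⟨c', hc, hc'⟩, hac, hbc⟩
  have hlub : IsLUB {z | ∃ w, WayBelow z w ∧ WayBelow w y} y := by
    constructor
    · rintro a ⟨a', haa', ha'⟩
      exact haa'.le.trans ha'.le
    · intro b hb
      exact (hL.isLUB y).2 fun w hw => (hL.isLUB w).2 fun z hz => hb ⟨w, hz, hw⟩
  obtain ⟨z, ⟨w, hzw, hwy⟩, hxz⟩ := h _ hdir y hlub le_rfl
  exact ⟨w, WayBelow.le_trans hxz hzw, hwy⟩

theorem directedOn (hL : IsContinuousDcpo L) (y : L) :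
    DirectedOn WayBelow {z | WayBelow z y} := by
  intro a ha b hb
  obtain ⟨c, hc, hac, hbc⟩ := (hL.isDirectedSet y).2 a ha b hb
  obtain ⟨d, hcd, hdy⟩ := hL.interpolate hc
  exact ⟨d, hdy, WayBelow.le_trans hac hcd, WayBelow.le_trans hbc hcd⟩

theorem le_of_forall_wayBelow (hL : IsContinuousDcpo L) {x y : L}
    (h : ∀ z, WayBelow z x → WayBelow z y) : x ≤ y :=
  (hL.isLUB x).2 fun z hz => (h z hz).le

/-- An element way below the supremum of a directed set is way below a member of the set. -/
theorem exists_mem_wayBelow (hL : IsContinuousDcpo L) {D : Set L} (hD : IsDirectedSet D) {x s : L}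
    (hs : IsLUB D s) (h : WayBelow x s) : ∃ d ∈ D, WayBelow x d := by
  obtain ⟨z, hxz, hzs⟩ := hL.interpolate h
  obtain ⟨d, hd, hzd⟩ := hzs D hD s hs le_rfl
  exact ⟨d, hd, hxz.trans_le hzd⟩

/-- The `ε`-`δ` form of Scott continuity. -/
theorem exists_wayBelow_map (hL : IsContinuousDcpo L) (hP : IsContinuousDcpo P) (g : ScottMap L P)
    {y : P} {x : L} (h : WayBelow y (g.toFun x)) :
    ∃ z, WayBelow z x ∧ WayBelow y (g.toFun z) := by
  obtain ⟨_, ⟨z, hz, rfl⟩, hyz⟩ := hP.exists_mem_wayBelow ((hL.isDirectedSet x).image g.monotone)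
    (g.scott (hL.isDirectedSet x).1 (hL.isDirectedSet x).2 (hL.isLUB x)) h
  exact ⟨z, hz, hyz⟩

end IsContinuousDcpo

/-! ### FS-domains are continuous -/

/-- Directed suprema of Scott continuous maps into a dcpo are computed pointwise. -/
theorem isLUB_apply (hP : IsDcpo P) {D : Set (ScottMap L P)} (hD : IsDirectedSet D)
    {g : ScottMap L P} (hg : IsLUB D g) (x : L) :
    IsLUB ((fun f : ScottMap L P => f.toFun x) '' D) (g.toFun x) := by
  have hdir : ∀ x : L, IsDirectedSet ((fun f : ScottMap L P => f.toFun x) '' D) :=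
    fun x => hD.image (f := fun f : ScottMap L P => f.toFun x) fun f f' h => h x
  choose s hs using fun x => hP _ (hdir x)
  have hle : ∀ f ∈ D, ∀ x, f.toFun x ≤ s x := fun f hf x => (hs x).1 ⟨f, hf, rfl⟩
  have hmono : Monotone s := fun x y hxy => (hs x).2 <| by
    rintro _ ⟨f, hf, rfl⟩
    exact (f.monotone hxy).trans (hle f hf y)
  have hscott : ScottContinuous s := by
    intro d hd hdd a ha
    constructor
    · rintro _ ⟨x, hx, rfl⟩
      exact hmono (ha.1 hx)
    · intro b hb
      refine (hs a).2 ?_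
      rintro _ ⟨f, hf, rfl⟩
      refine (f.scott hd hdd ha).2 ?_
      rintro _ ⟨x, hx, rfl⟩
      exact (hle f hf x).trans (hb ⟨x, hx, rfl⟩)
  constructor
  · rintro _ ⟨f, hf, rfl⟩
    exact hg.1 hf x
  · intro b hb
    have hgs : g ≤ ⟨s, hscott⟩ := hg.2 fun f hf x => hle f hf x
    exact (hgs x).trans ((hs x).2 hb)

theorem IsFinitelySeparating.wayBelow {δ : ScottMap L L} (hδ : IsFinitelySeparating δ) (x : L) :
    WayBelow (δ.toFun x) x := by
  obtain ⟨M, hM, hsep⟩ := hδ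
  intro D hD s hs hxs
  obtain ⟨m, -, hm⟩ := exists_cofinal_of_finite (r := (· ≤ ·)) (fun _ _ _ => _root_.le_trans)
    hD.1 hD.2 hM (p := fun d m => δ.toFun d ≤ m ∧ m ≤ d) fun d _ => hsep d
  obtain ⟨e, he⟩ := hD.1
  obtain ⟨d, hd, -, -, hmd⟩ := hm e he
  refine ⟨d, hd, (δ.monotone hxs).trans (_root_.le_trans ?_ hmd)⟩
  refine (δ.scott hD.1 hD.2 hs).2 ?_
  rintro _ ⟨a, ha, rfl⟩
  obtain ⟨b, -, hab, hbm, -⟩ := hm a ha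
  exact (δ.monotone hab).trans hbm

theorem IsFSDomain.isContinuousDcpo (hL : IsFSDomain L) : IsContinuousDcpo L := by
  obtain ⟨hdcpo, D, ⟨hD, hlub⟩, hfs⟩ := hL
  have hpt : ∀ x : L, IsLUB ((fun f : ScottMap L L => f.toFun x) '' D) x :=
    fun x => isLUB_apply hdcpo hD hlub x
  have hdir : ∀ x : L, IsDirectedSet ((fun f : ScottMap L L => f.toFun x) '' D) :=
    fun x => hD.image (f := fun f : ScottMap L L => f.toFun x) fun f f' h => h x
  refine ⟨hdcpo, fun y => ⟨?_, ?_⟩, fun y => ⟨fun z hz => hz.le, fun b hb => ?_⟩⟩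
  · obtain ⟨δ, hδ⟩ := hD.1
    exact ⟨_, (hfs δ hδ).wayBelow y⟩
  · intro a ha b hb
    obtain ⟨_, ⟨δ, hδ, rfl⟩, haδ⟩ := ha _ (hdir y) y (hpt y) le_rfl
    obtain ⟨_, ⟨ε, hε, rfl⟩, hbε⟩ := hb _ (hdir y) y (hpt y) le_rfl
    obtain ⟨κ, hκ, hδκ, hεκ⟩ := hD.2 δ hδ ε hε
    exact ⟨κ.toFun y, (hfs κ hκ).wayBelow y, haδ.trans (hδκ y), hbε.trans (hεκ y)⟩
  · refine (hpt y).2 ?_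
    rintro _ ⟨δ, hδ, rfl⟩
    exact hb ((hfs δ hδ).wayBelow y)

/-! ### The space induced by a continuous dcpo -/

theorem le_topElt (F : (induced L).family) (x : L) (hx : x ∈ F.1) : x ≤ topElt F :=
  (isGreatest_topElt F).2 hx

theorem topElt_mem (F : (induced L).family) : topElt F ∈ F.1 :=
  (isGreatest_topElt F).1

/-- The singleton `{x}` as a member of `𝓕_L`. -/
def single (x : L) : (induced L).family :=
  ⟨({x} : Finset L), x, by rw [Finset.coe_singleton]; exact isGreatest_singleton⟩

@[simp]
theorem topElt_single (x : L) : topElt (single x) = x :=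
  Finset.mem_singleton.1 (topElt_mem (single x))

theorem mem_up_induced (F : (induced L).family) (x : L) :
    x ∈ (induced L).up F ↔ WayBelow x (topElt F) := by
  constructor
  · rintro ⟨y, hxy, hy⟩
    exact WayBelow.trans_le (L := L) hxy (le_topElt F _ hy)
  · intro h
    exact ⟨topElt (L := L) F, h, topElt_mem (L := L) F⟩

theorem subset_up_induced {F G : (induced L).family} :
    (F.1 : Set (induced L).carrier) ⊆ (induced L).up G ↔ WayBelow (topElt F) (topElt G) :=
  ⟨fun h => (mem_up_induced G _).1 (h (topElt_mem F)),
    fun h _ hx => (mem_up_induced G _).2 (WayBelow.le_trans (L := L) (le_topElt F _ hx) h)⟩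

theorem IsContinuousDcpo.isCF_induced [hne : Nonempty L] (hL : IsContinuousDcpo L) :
    (induced L).IsCF where
  carrier_nonempty := hne
  rel_nonempty := by
    obtain ⟨y⟩ := hne
    obtain ⟨z, hz⟩ := hL.exists_wayBelow y
    exact ⟨z, y, hz⟩
  rel_trans _ _ _ := WayBelow.trans
  family_nonempty := ⟨_, (single hne.some).2⟩
  consistent F K hK := by
    obtain ⟨z, hz, hKz⟩ := exists_upper_bound_of_finite (α := L) (r := WayBelow)
      (fun _ _ _ => WayBelow.trans)
      (hL.exists_wayBelow (topElt F)) (hL.directedOn (topElt F)) K.finite_toSet (fun k => k)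
      fun k hk => (mem_up_induced F k).1 (hK hk)
    refine ⟨single z, fun k hk => (mem_up_induced (single z) k).2 ?_, subset_up_induced.2 ?_⟩
    · rw [topElt_single z]
      exact hKz k hk
    · rwa [topElt_single]

theorem isCFApproximable_Omega (hL : IsContinuousDcpo L) (hP : IsContinuousDcpo P)
    (g : ScottMap L P) : IsCFApproximable (Omega g) where
  total F := by
    obtain ⟨z, hz⟩ := hP.exists_wayBelow (g.toFun (topElt F))
    exact ⟨single z, by rwa [Omega, topElt_single]⟩
  left F F' G hF h := h.trans_le (g.monotone (subset_up_induced.1 hF).le)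
  right F G G' h hG := (subset_up_induced.1 hG).trans h
  interpolate F G h := by
    obtain ⟨w, hGw, hw⟩ := hP.interpolate h
    obtain ⟨z, hz, hwz⟩ := hL.exists_wayBelow_map hP g hw
    refine ⟨single z, single w, subset_up_induced.2 ?_, subset_up_induced.2 ?_, ?_⟩
    · rwa [topElt_single]
    · rwa [topElt_single]
    · rwa [Omega, topElt_single, topElt_single]
  directed F G₁ G₂ h₁ h₂ := by
    obtain ⟨z, hz, h₁z, h₂z⟩ := hP.directedOn _ _ h₁ _ h₂
    refine ⟨single z, Set.union_subset (subset_up_induced.2 ?_) (subset_up_induced.2 ?_), ?_⟩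
    · rwa [topElt_single]
    · rwa [topElt_single]
    · rwa [Omega, topElt_single]

theorem Omega_id : Omega (ScottMap.id L) = (induced L).idRel := by
  funext F G
  exact propext subset_up_induced.symm

theorem Omega_comp {Q : Type u} [PartialOrder Q] (hP : IsContinuousDcpo P)
    (hQ : IsContinuousDcpo Q) (g : ScottMap P Q) (h : ScottMap L P) :
    Omega (ScottMap.comp g h) = compRel (Omega g) (Omega h) := by
  funext F H
  refine propext ⟨fun hFH => ?_, ?_⟩
  · obtain ⟨z, hz, hHz⟩ := hP.exists_wayBelow_map hQ g hFH
    refine ⟨single z, ?_, ?_⟩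
    · rwa [Omega, topElt_single]
    · rwa [Omega, topElt_single]
  · rintro ⟨G, hFG, hGH⟩
    exact WayBelow.trans_le hGH (g.monotone hFG.le)

theorem Omega_injective (hP : IsContinuousDcpo P) :
    Function.Injective (Omega : ScottMap L P → _) := by
  intro g g' h
  have key : ∀ x z, WayBelow z (g.toFun x) ↔ WayBelow z (g'.toFun x) := fun x z => by
    have := congrFun (congrFun h (single x)) (single z)
    simpa only [Omega, topElt_single, eq_iff_iff] using this
  refine ScottMap.ext (funext fun x => le_antisymm ?_ ?_)
  · exact hP.le_of_forall_wayBelow fun z => (key x z).1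
  · exact hP.le_of_forall_wayBelow fun z => (key x z).2

/-- `(L, ≪, 𝓕_L)` is an FS-approximation space, by means of the relations `Ω_δ` for `δ` in an
approximate identity of finitely separating maps. -/
theorem IsFSDomain.isFS_induced [Nonempty L] (hL : IsFSDomain L) : (induced L).IsFS := by
  have hc := hL.isContinuousDcpo
  obtain ⟨hdcpo, D, ⟨hD, hlub⟩, hfs⟩ := hL
  refine ⟨hc.isCF_induced, Omega '' D, hD.image ?_, ?_, fun F G => ?_, ?_⟩
  · exact fun δ ε h F G hFG => WayBelow.trans_le hFG (h _)
  · rintro _ ⟨δ, -, rfl⟩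
    exact isCFApproximable_Omega hc hc δ
  · rw [ApproxTriple.idRel, subset_up_induced]
    constructor
    · rintro ⟨_, ⟨δ, hδ, rfl⟩, h⟩
      exact WayBelow.trans_le h (hlub.1 hδ _)
    · intro h
      obtain ⟨_, ⟨δ, hδ, rfl⟩, hGδ⟩ := hc.exists_mem_wayBelow
        (hD.image (f := fun f : ScottMap L L => f.toFun (topElt F)) fun f f' h => h _)
        (isLUB_apply hdcpo hD hlub (topElt F)) h
      exact ⟨_, ⟨δ, hδ, rfl⟩, hGδ⟩
  · rintro _ ⟨δ, hδ, rfl⟩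
    obtain ⟨M, hM, hsep⟩ := hfs δ hδ
    refine ⟨single '' M, hM.image _, fun F => ?_⟩
    obtain ⟨m, hm, hδm, hmF⟩ := hsep (topElt F)
    refine ⟨single m, ⟨m, hm, rfl⟩, fun G hG => ⟨subset_up_induced.2 ?_, fun x hx => ?_⟩⟩
    · rw [topElt_single]
      exact WayBelow.trans_le hG hδm
    · have hx' : WayBelow (P := L) x _ := (mem_up_induced (single m) x).1 hx
      rw [topElt_single] at hx'
      exact (mem_up_induced F x).2 (hx'.trans_le hmF)

/-! ### The Scott continuous map of a CF-approximable relation -/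

/-- `{G | F Θ G}` depends only on `c_F`, monotonically. -/
theorem IsCFApproximable.congr_left {B : ApproxTriple.{u}}
    {Θ : (induced L).family → B.family → Prop} (hΘ : IsCFApproximable Θ)
    {F F' : (induced L).family} (h : topElt F ≤ topElt F') {G : B.family} (hFG : Θ F G) :
    Θ F' G := by
  obtain ⟨F'', G'', hF, hG, hΘ'⟩ := hΘ.interpolate _ _ hFG
  exact hΘ.right _ _ _
    (hΘ.left _ _ _ (subset_up_induced.2 ((subset_up_induced.1 hF).trans_le h)) hΘ') hG

theorem isDirectedSet_topElt {A : ApproxTriple.{u}} {Θ : A.family → (induced P).family → Prop}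
    (hΘ : IsCFApproximable Θ) (F : A.family) : IsDirectedSet (topElt '' {G | Θ F G}) := by
  constructor
  · obtain ⟨G, hG⟩ := hΘ.total F
    exact ⟨_, G, hG, rfl⟩
  · rintro _ ⟨G₁, h₁, rfl⟩ _ ⟨G₂, h₂, rfl⟩
    obtain ⟨G, hG, hFG⟩ := hΘ.directed _ _ _ h₁ h₂
    rw [Set.union_subset_iff] at hG
    exact ⟨_, ⟨G, hFG, rfl⟩, (subset_up_induced.1 hG.1).le, (subset_up_induced.1 hG.2).le⟩

/-- Every CF-approximable relation between spaces induced by continuous dcpos is `Ω_g` for the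
Scott continuous map `g x = sup {c_G | {x} Θ G}`. -/
theorem exists_Omega_eq (hP : IsContinuousDcpo P)
    {Θ : (induced L).family → (induced P).family → Prop} (hΘ : IsCFApproximable Θ) :
    ∃ g : ScottMap L P, Omega g = Θ := by
  choose g hg using fun x => hP.isDcpo _ (isDirectedSet_topElt hΘ (single x))
  have hmono : Monotone g := fun x y hxy => (hg x).2 <| by
    rintro _ ⟨G, hG, rfl⟩
    exact (hg y).1 ⟨G, hΘ.congr_left (by simpa using hxy) hG, rfl⟩
  have hscott : ScottContinuous g := by
    intro d hd hdd a ha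
    constructor
    · rintro _ ⟨x, hx, rfl⟩
      exact hmono (ha.1 hx)
    · intro b hb
      refine (hg a).2 ?_
      rintro _ ⟨G, hG, rfl⟩
      obtain ⟨F, G', hF, hG', hFG'⟩ := hΘ.interpolate _ _ hG
      rw [subset_up_induced, topElt_single] at hF
      obtain ⟨x, hx, hFx⟩ := hF d ⟨hd, hdd⟩ a ha le_rfl
      refine _root_.le_trans ((hg x).1 ⟨G, ?_, rfl⟩) (hb ⟨x, hx, rfl⟩)
      exact hΘ.congr_left (by simpa using hFx) (hΘ.right _ _ _ hFG' hG')
  refine ⟨⟨g, hscott⟩, ?_⟩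
  funext F G
  refine propext ⟨fun h => ?_, fun h => ?_⟩
  · obtain ⟨_, ⟨G', hG', rfl⟩, hGG'⟩ :=
      hP.exists_mem_wayBelow (isDirectedSet_topElt hΘ (single (topElt F))) (hg (topElt F)) h
    exact hΘ.congr_left (by simp) (hΘ.right _ _ _ hG' (subset_up_induced.2 hGG'))
  · obtain ⟨F', G', hF, hG, hFG⟩ := hΘ.interpolate _ _ h
    refine (subset_up_induced.1 hG).trans_le ((hg (topElt F)).1 ⟨G', ?_, rfl⟩)
    exact hΘ.congr_left (by simpa using (subset_up_induced.1 hF).le) hFG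

end Order

/-! ### The rounded ideal completion of a CF-approximation space -/

/-- Rounded ideals of the abstract basis `𝓕`, where `G` is below `F` if `G ⊆ R̄(F)`: nonempty sets
of members of the family that are closed downwards and directed for this relation. As the relation
need not be reflexive, directedness includes the requirement that every member of the ideal has
another one strictly above it. -/
structure IsRoundedIdeal {A : ApproxTriple.{u}} (I : Set A.family) : Prop where
  nonempty : I.Nonempty
  lower : ∀ F G, F ∈ I → A.idRel F G → G ∈ I
  directed : DirectedOn (flip A.idRel) I

/-- The rounded ideals of `𝓕`, ordered by inclusion. -/
abbrev RoundedIdeal (A : ApproxTriple.{u}) : Type u :=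
  {I : Set A.family // IsRoundedIdeal I}

section Ideal

variable {A : ApproxTriple.{u}}

theorem ApproxTriple.IsCF.idRel_trans (hA : A.IsCF) {F G H : A.family} (h : A.idRel F G)
    (h' : A.idRel G H) : A.idRel F H :=
  (isCFApproximable_idRel hA).left _ _ _ h h'

/-- The rounded ideal `{G | F Θ G}` attached to `F` by a CF-approximable relation. -/
def imageIdeal {B : ApproxTriple.{u}} {Θ : A.family → B.family → Prop} (hΘ : IsCFApproximable Θ)
    (F : A.family) : RoundedIdeal B :=
  ⟨{G | Θ F G}, hΘ.total F, fun _ _ h h' => hΘ.right _ _ _ h h', fun _ h₁ _ h₂ => by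
    obtain ⟨G, hG, hFG⟩ := hΘ.directed _ _ _ h₁ h₂
    rw [Set.union_subset_iff] at hG
    exact ⟨G, hFG, hG.1, hG.2⟩⟩

/-- The principal rounded ideal `↓F = {G | G ⊆ R̄(F)}`. -/
def principal (hA : A.IsCF) (F : A.family) : RoundedIdeal A :=
  imageIdeal (isCFApproximable_idRel hA) F

theorem principal_le_of_mem (hA : A.IsCF) {I : RoundedIdeal A} {F : A.family} (hF : F ∈ I.1) :
    principal hA F ≤ I :=
  fun G hG => I.2.lower F G hF hG

theorem principal_mono (hA : A.IsCF) {F G : A.family} (h : A.idRel F G) :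
    principal hA G ≤ principal hA F :=
  principal_le_of_mem hA h

theorem exists_isLUB_union {D : Set (RoundedIdeal A)} (hD : IsDirectedSet D) :
    ∃ S, IsLUB D S ∧ ∀ F, F ∈ S.1 ↔ ∃ I ∈ D, F ∈ I.1 := by
  refine ⟨⟨{F | ∃ I ∈ D, F ∈ I.1}, ?_, ?_, ?_⟩, ⟨fun I hI F hF => ⟨I, hI, hF⟩, ?_⟩,
    fun F => Iff.rfl⟩
  · obtain ⟨I, hI⟩ := hD.1
    obtain ⟨F, hF⟩ := I.2.nonempty
    exact ⟨F, I, hI, hF⟩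
  · rintro F G ⟨I, hI, hF⟩ h
    exact ⟨I, hI, I.2.lower F G hF h⟩
  · rintro F ⟨I, hI, hF⟩ G ⟨J, hJ, hG⟩
    obtain ⟨K, hK, hIK, hJK⟩ := hD.2 I hI J hJ
    obtain ⟨H, hH, h⟩ := K.2.directed F (hIK hF) G (hJK hG)
    exact ⟨H, ⟨K, hK, hH⟩, h⟩
  · rintro J hJ F ⟨I, hI, hF⟩
    exact hJ hI hF

theorem isDcpo_roundedIdeal : IsDcpo (RoundedIdeal A) := fun _ hD =>
  (exists_isLUB_union hD).imp fun _ h => h.1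

theorem mem_isLUB {D : Set (RoundedIdeal A)} (hD : IsDirectedSet D) {S : RoundedIdeal A}
    (hS : IsLUB D S) {F : A.family} : F ∈ S.1 ↔ ∃ I ∈ D, F ∈ I.1 := by
  obtain ⟨S', hS', h⟩ := exists_isLUB_union hD
  rw [hS.unique hS', h]

theorem isDirectedSet_principal (hA : A.IsCF) (I : RoundedIdeal A) :
    IsDirectedSet (principal hA '' I.1) := by
  refine ⟨I.2.nonempty.image _, ?_⟩
  rintro _ ⟨F, hF, rfl⟩ _ ⟨G, hG, rfl⟩
  obtain ⟨H, hH, hFH, hGH⟩ := I.2.directed F hF G hG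
  exact ⟨_, ⟨H, hH, rfl⟩, principal_mono hA hFH, principal_mono hA hGH⟩

theorem isLUB_principal (hA : A.IsCF) (I : RoundedIdeal A) : IsLUB (principal hA '' I.1) I := by
  constructor
  · rintro _ ⟨F, hF, rfl⟩
    exact principal_le_of_mem hA hF
  · intro J hJ F hF
    obtain ⟨G, hG, hFG, -⟩ := I.2.directed F hF F hF
    exact hJ ⟨G, hG, rfl⟩ hFG

theorem wayBelow_iff (hA : A.IsCF) {I J : RoundedIdeal A} :
    WayBelow I J ↔ ∃ G ∈ J.1, I ≤ principal hA G := by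
  constructor
  · intro h
    obtain ⟨_, ⟨G, hG, rfl⟩, hIG⟩ :=
      h _ (isDirectedSet_principal hA J) J (isLUB_principal hA J) le_rfl
    exact ⟨G, hG, hIG⟩
  · rintro ⟨G, hG, hIG⟩ D hD S hS hJS
    obtain ⟨K, hK, hGK⟩ := (mem_isLUB hD hS).1 (hJS hG)
    exact ⟨K, hK, hIG.trans (principal_le_of_mem hA hGK)⟩

theorem wayBelow_principal_iff (hA : A.IsCF) {I : RoundedIdeal A} {F : A.family} :
    WayBelow I (principal hA F) ↔ ∃ G, A.idRel F G ∧ I ≤ principal hA G :=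
  wayBelow_iff hA

theorem principal_wayBelow (hA : A.IsCF) {I : RoundedIdeal A} {F : A.family} (hF : F ∈ I.1) :
    WayBelow (principal hA F) I :=
  (wayBelow_iff hA).2 ⟨F, hF, le_rfl⟩

/-- The Scott continuous map `I ↦ {G | ∃ F ∈ I, F Θ G}` between rounded ideal completions given by
a CF-approximable relation `Θ`. -/
def idealMap {B : ApproxTriple.{u}} {Θ : A.family → B.family → Prop} (hΘ : IsCFApproximable Θ) :
    ScottMap (RoundedIdeal A) (RoundedIdeal B) where
  toFun I := ⟨{G | ∃ F ∈ I.1, Θ F G}, by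
    obtain ⟨F, hF⟩ := I.2.nonempty
    obtain ⟨G, hG⟩ := hΘ.total F
    exact ⟨G, F, hF, hG⟩, by
    rintro G H ⟨F, hF, hFG⟩ h
    exact ⟨F, hF, hΘ.right _ _ _ hFG h⟩, by
    rintro G₁ ⟨F₁, hF₁, h₁⟩ G₂ ⟨F₂, hF₂, h₂⟩
    obtain ⟨F, hF, hF₁F, hF₂F⟩ := I.2.directed _ hF₁ _ hF₂
    obtain ⟨G, hG, hG₁, hG₂⟩ :=
      (imageIdeal hΘ F).2.directed G₁ (hΘ.left _ _ _ hF₁F h₁) G₂ (hΘ.left _ _ _ hF₂F h₂)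
    exact ⟨G, ⟨F, hF, hG⟩, hG₁, hG₂⟩⟩
  scott := by
    intro D hne hD S hS
    constructor
    · rintro _ ⟨I, hI, rfl⟩ G ⟨F, hF, hFG⟩
      exact ⟨F, hS.1 hI hF, hFG⟩
    · rintro J hJ G ⟨F, hF, hFG⟩
      obtain ⟨I, hI, hFI⟩ := (mem_isLUB ⟨hne, hD⟩ hS).1 hF
      exact hJ ⟨I, hI, rfl⟩ ⟨F, hFI, hFG⟩

/-- The hypothesis provides an `M ∈ 𝓜` for each single `F`. Since `𝓜` is finite, one `M` serves
cofinally many members `F` of a given rounded ideal `I`, and its principal ideal lies between the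
image of `I` and `I`. -/
theorem isFinitelySeparating_idealMap (hA : A.IsCF) {Θ : A.family → A.family → Prop}
    (hΘ : IsCFApproximable Θ) {𝓜 : Set A.family} (hfin : 𝓜.Finite)
    (hsep : ∀ F, ∃ M ∈ 𝓜, ∀ G, Θ F G → (G.1 : Set A.carrier) ⊆ A.up M ∧ A.up M ⊆ A.up F) :
    IsFinitelySeparating (idealMap hΘ) := by
  refine ⟨principal hA '' 𝓜, hfin.image _, fun I => ?_⟩
  obtain ⟨M, hM, hcof⟩ := exists_cofinal_of_finite (r := flip A.idRel)
    (fun _ _ _ h h' => hA.idRel_trans h' h) I.2.nonempty I.2.directed hfin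
    (p := fun F M => ∀ G, Θ F G → (G.1 : Set A.carrier) ⊆ A.up M ∧ A.up M ⊆ A.up F)
    fun F _ => hsep F
  refine ⟨_, ⟨M, hM, rfl⟩, ?_, ?_⟩
  · rintro G ⟨F, hF, hFG⟩
    obtain ⟨F', -, hFF', h⟩ := hcof F hF
    exact (h G (hΘ.left _ _ _ hFF' hFG)).1
  · obtain ⟨F, hF⟩ := I.2.nonempty
    obtain ⟨F', hF', -, h⟩ := hcof F hF
    obtain ⟨G, hG⟩ := hΘ.total F'
    exact fun H hH => I.2.lower F' H hF' (Set.Subset.trans hH (h G hG).2)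

theorem ApproxTriple.IsFS.isFSDomain_roundedIdeal (hA : A.IsFS) : IsFSDomain (RoundedIdeal A) := by
  obtain ⟨hCF, S, hS, happ, hunion, hsep⟩ := hA
  refine ⟨isDcpo_roundedIdeal, {δ | ∃ Θ, ∃ h : Θ ∈ S, δ = idealMap (happ Θ h)},
    ⟨⟨?_, ?_⟩, ?_, ?_⟩, ?_⟩
  · obtain ⟨Θ, hΘ⟩ := hS.1
    exact ⟨_, Θ, hΘ, rfl⟩
  · rintro _ ⟨Θ, hΘ, rfl⟩ _ ⟨Υ, hΥ, rfl⟩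
    obtain ⟨Ψ, hΨ, hΘΨ, hΥΨ⟩ := hS.2 Θ hΘ Υ hΥ
    refine ⟨_, ⟨Ψ, hΨ, rfl⟩, ?_, ?_⟩
    · rintro I G ⟨F, hF, h⟩
      exact ⟨F, hF, hΘΨ F G h⟩
    · rintro I G ⟨F, hF, h⟩
      exact ⟨F, hF, hΥΨ F G h⟩
  · rintro _ ⟨Θ, hΘ, rfl⟩ I G ⟨F, hF, h⟩
    exact I.2.lower F G hF ((hunion F G).1 ⟨Θ, hΘ, h⟩)
  · intro g hg I G hG
    -- `G` lies below some `F ∈ I` by roundedness, and `Id` is the union of the relations in `S`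
    obtain ⟨F, hF, hFG, -⟩ := I.2.directed G hG G hG
    obtain ⟨Θ, hΘ, h⟩ := (hunion F G).2 hFG
    exact hg ⟨Θ, hΘ, rfl⟩ I ⟨F, hF, h⟩
  · rintro _ ⟨Θ, hΘ, rfl⟩
    obtain ⟨𝓜, hfin, h⟩ := hsep Θ hΘ
    exact isFinitelySeparating_idealMap hCF (happ Θ hΘ) hfin h

/-! ### A space is isomorphic to the one induced by its completion -/

/-- The relation `{(F, G) | G ∈ c_F}` from the space induced by the completion to the space. -/
def evalRel (A : ApproxTriple.{u}) : (induced (RoundedIdeal A)).family → A.family → Prop :=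
  fun F G => G ∈ (topElt F).1

/-- The relation `{(G, F) | c_F ≪ ↓G}` from a space to the space induced by its completion. -/
def unitRel (hA : A.IsCF) : A.family → (induced (RoundedIdeal A)).family → Prop :=
  fun G F => WayBelow (topElt F) (principal hA G)

theorem isCFApproximable_evalRel (hA : A.IsCF) : IsCFApproximable (evalRel A) where
  total F := (topElt F).2.nonempty
  left F F' G hF h := (subset_up_induced.1 hF).le h
  right F G G' h hG := (topElt F).2.lower G G' h hG
  interpolate F G h := by
    obtain ⟨G', hG', hGG', -⟩ := (topElt F).2.directed G h G h
    obtain ⟨G'', hG'', hG'G'', -⟩ := (topElt F).2.directed G' hG' G' hG'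
    refine ⟨single (principal hA G''), G', subset_up_induced.2 ?_, hGG', ?_⟩
    · rw [topElt_single]
      exact principal_wayBelow hA hG''
    · rw [evalRel, topElt_single]
      exact hG'G''
  directed F G₁ G₂ h₁ h₂ := by
    obtain ⟨G, hG, hG₁, hG₂⟩ := (topElt F).2.directed G₁ h₁ G₂ h₂
    exact ⟨G, Set.union_subset hG₁ hG₂, hG⟩

theorem isCFApproximable_unitRel (hA : A.IsCF) : IsCFApproximable (unitRel hA) where
  total G := by
    obtain ⟨H, hH⟩ := (isCFApproximable_idRel hA).total G
    exact ⟨single (principal hA H), by rw [unitRel, topElt_single]; exact principal_wayBelow hA hH⟩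
  left G G' F hG h := h.trans_le (principal_mono hA hG)
  right G F F' h hF := (subset_up_induced.1 hF).trans h
  interpolate G F h := by
    obtain ⟨H, hGH, hFH⟩ := (wayBelow_principal_iff hA).1 h
    obtain ⟨H₂, hH₂, hH, -⟩ := (principal hA G).2.directed H hGH H hGH
    obtain ⟨H₁, hH₁, hH', -⟩ := (principal hA H₂).2.directed H hH H hH
    refine ⟨H₂, single (principal hA H₁), hH₂, subset_up_induced.2 ?_, ?_⟩
    · rw [topElt_single]
      exact WayBelow.le_trans hFH (principal_wayBelow hA hH')
    · rw [unitRel, topElt_single]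
      exact principal_wayBelow hA hH₁
  directed G F₁ F₂ h₁ h₂ := by
    obtain ⟨H₁, hGH₁, hF₁⟩ := (wayBelow_principal_iff hA).1 h₁
    obtain ⟨H₂, hGH₂, hF₂⟩ := (wayBelow_principal_iff hA).1 h₂
    obtain ⟨H, hH, hH₁, hH₂⟩ := (principal hA G).2.directed H₁ hGH₁ H₂ hGH₂
    refine ⟨single (principal hA H), Set.union_subset (subset_up_induced.2 ?_)
      (subset_up_induced.2 ?_), ?_⟩
    · rw [topElt_single]
      exact WayBelow.le_trans hF₁ (principal_wayBelow hA hH₁)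
    · rw [topElt_single]
      exact WayBelow.le_trans hF₂ (principal_wayBelow hA hH₂)
    · rw [unitRel, topElt_single]
      exact principal_wayBelow hA hH

theorem compRel_unitRel_evalRel (hA : A.IsCF) :
    compRel (unitRel hA) (evalRel A) = (induced (RoundedIdeal A)).idRel := by
  funext F F'
  refine propext (Iff.trans ⟨?_, fun h => ?_⟩ subset_up_induced.symm)
  · rintro ⟨G, hG, h⟩
    exact WayBelow.trans_le h (principal_le_of_mem hA hG)
  · obtain ⟨G, hG, hF'⟩ := (wayBelow_iff hA).1 h
    obtain ⟨H, hH, hGH, -⟩ := (topElt F).2.directed G hG G hG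
    exact ⟨H, hH, WayBelow.le_trans hF' (principal_wayBelow hA hGH)⟩

theorem compRel_evalRel_unitRel (hA : A.IsCF) :
    compRel (evalRel A) (unitRel hA) = A.idRel := by
  funext G G'
  refine propext ⟨?_, fun h => ?_⟩
  · rintro ⟨F, hF, h⟩
    exact hF.le h
  · obtain ⟨H, hH, hG', -⟩ := (principal hA G).2.directed G' h G' h
    refine ⟨single (principal hA H), ?_, ?_⟩
    · rw [unitRel, topElt_single]
      exact principal_wayBelow hA hH
    · rw [evalRel, topElt_single]
      exact hG'

end Ideal

/-- The rounded ideal completion of an FS-approximation space as an FS-domain. -/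
def FSApps.completion (A : FSApps.{u}) : FSDom.{u} :=
  haveI : Nonempty (RoundedIdeal A.triple) :=
    A.isFS.1.family_nonempty.elim fun F hF => ⟨principal A.isFS.1 ⟨F, hF⟩⟩
  { carrier := RoundedIdeal A.triple
    isFSDomain := A.isFS.isFSDomain_roundedIdeal }

/-- The isomorphism between an FS-approximation space and the space induced by its completion. -/
def FSApps.completionIso (hobj : ∀ L : FSDom.{u}, (induced L.carrier).IsFS) (A : FSApps.{u}) :
    inducedObj hobj A.completion ≅ A where
  hom := FSApps.Hom.mk (A := inducedObj hobj A.completion) (evalRel A.triple)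
    (isCFApproximable_evalRel A.isFS.1)
  inv := FSApps.Hom.mk (B := inducedObj hobj A.completion) (unitRel A.isFS.1)
    (isCFApproximable_unitRel A.isFS.1)
  hom_inv_id := FSApps.Hom.ext (compRel_unitRel_evalRel A.isFS.1)
  inv_hom_id := FSApps.Hom.ext (compRel_evalRel_unitRel A.isFS.1)

theorem FSDom.isContinuousDcpo (L : FSDom.{u}) : IsContinuousDcpo L.carrier :=
  L.isFSDomain.isContinuousDcpo

end FSApprox

/-- **FS-APPS** and **FS-DOM** are equivalent; moreover `L ↦ (L, ≪, 𝓕_L)`, `g ↦ Ω_g` is a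
well-defined functor **FS-DOM** ⥤ **FS-APPS** (the existential quantifiers over propositions assert
well-definedness and functoriality) which is full, faithful and essentially surjective. -/
theorem mainTheorem10 :
    Nonempty (FSApprox.FSApps.{u} ≌ FSApprox.FSDom.{u}) ∧
    ∃ (hobj : ∀ L : FSApprox.FSDom.{u}, (FSApprox.induced L.carrier).IsFS)
      (hmap : ∀ (L P : FSApprox.FSDom.{u}) (g : FSApprox.ScottMap L.carrier P.carrier),
        FSApprox.IsCFApproximable (FSApprox.Omega g))
      (hid : ∀ L : FSApprox.FSDom.{u},
        FSApprox.inducedMap hobj hmap (𝟙 L) = 𝟙 (FSApprox.inducedObj hobj L))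
      (hcomp : ∀ (L P Q : FSApprox.FSDom.{u}) (h : L ⟶ P) (g : P ⟶ Q),
        FSApprox.inducedMap hobj hmap (h ≫ g) =
          FSApprox.inducedMap hobj hmap h ≫ FSApprox.inducedMap hobj hmap g),
      (FSApprox.inducedFunctor hobj hmap hid hcomp).Full ∧
      (FSApprox.inducedFunctor hobj hmap hid hcomp).Faithful ∧
      (FSApprox.inducedFunctor hobj hmap hid hcomp).EssSurj := by
  have hobj : ∀ L : FSApprox.FSDom.{u}, (FSApprox.induced L.carrier).IsFS :=
    fun L => L.isFSDomain.isFS_induced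
  have hmap : ∀ (L P : FSApprox.FSDom.{u}) (g : FSApprox.ScottMap L.carrier P.carrier),
      FSApprox.IsCFApproximable (FSApprox.Omega g) :=
    fun L P g => FSApprox.isCFApproximable_Omega L.isContinuousDcpo P.isContinuousDcpo g
  have hid : ∀ L : FSApprox.FSDom.{u},
      FSApprox.inducedMap hobj hmap (𝟙 L) = 𝟙 (FSApprox.inducedObj hobj L) :=
    fun L => FSApprox.FSApps.Hom.ext FSApprox.Omega_id
  have hcomp : ∀ (L P Q : FSApprox.FSDom.{u}) (h : L ⟶ P) (g : P ⟶ Q),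
      FSApprox.inducedMap hobj hmap (h ≫ g) =
        FSApprox.inducedMap hobj hmap h ≫ FSApprox.inducedMap hobj hmap g :=
    fun L P Q h g => FSApprox.FSApps.Hom.ext
      (FSApprox.Omega_comp P.isContinuousDcpo Q.isContinuousDcpo g h)
  have hfull : (FSApprox.inducedFunctor hobj hmap hid hcomp).Full := ⟨fun {L P} Θ => by
    obtain ⟨g, hg⟩ := FSApprox.exists_Omega_eq P.isContinuousDcpo
      Θ.isCFApproximable
    exact ⟨g, FSApprox.FSApps.Hom.ext hg⟩⟩
  have hfaithful : (FSApprox.inducedFunctor hobj hmap hid hcomp).Faithful := ⟨fun {L P} g g' h =>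
    FSApprox.Omega_injective P.isContinuousDcpo (congrArg FSApprox.FSApps.Hom.rel h)⟩
  have hess : (FSApprox.inducedFunctor hobj hmap hid hcomp).EssSurj :=
    ⟨fun A => ⟨A.completion, ⟨A.completionIso hobj⟩⟩⟩
  have hequiv : (FSApprox.inducedFunctor hobj hmap hid hcomp).IsEquivalence := {}
  exact ⟨⟨(FSApprox.inducedFunctor hobj hmap hid hcomp).asEquivalence.symm⟩,
    hobj, hmap, hid, hcomp, hfull, hfaithful, hess⟩
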